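/- Let $K/\mathbb{Q}$ be a (possibly infinite) algebraic field extension that is totally real, i.e. every field embedding $K\to\mathbb{C}$ has image contained in $\mathbb{R}$, and let $\overline{\mathbb{Q}}$ be an algebraic closure of $\mathbb{Q}$ containing $K$. Write $$H^4(\mathrm{Gal}(\overline{\mathbb{Q}}/K);\overline{\mathbb{Q}}^{\times})=\mathrm{colim}_{L}\,H^4(\mathrm{Gal}(L/K);L^{\times})$$ for the fourth Galois cohomology group, where $L$ ranges over the finite Galois extensions of $K$ inside $\overline{\mathbb{Q}}$ and the colimit is taken along the inflation maps. Then there is an injective group homomorphism $$\mathbb{Z}/2\hookrightarrow H^4(\mathrm{Gal}(\overline{\mathbb{Q}}/K);\overline{\mathbb{Q}}^{\times}).$$ -/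

import Mathlib

open CategoryTheory

namespace GaloisUnits

variable {K : Type*} {Ω : Type} [Field K] [Field Ω] [Algebra K Ω]

/-- For finite Galois subextensions `L₁ ⊆ L₂` of `Ω / K`, the restriction homomorphism
`Gal(L₂/K) → Gal(L₁/K)`. -/
noncomputable def restrict {L₁ L₂ : FiniteGaloisIntermediateField K Ω} (h : L₁ ≤ L₂) :
    Gal(L₂/K) →* Gal(L₁/K) :=
  letI : Algebra L₁ L₂ := (IntermediateField.inclusion h).toRingHom.toAlgebra
  haveI : IsScalarTower K L₁ L₂ := IsScalarTower.of_algebraMap_eq (fun _ => rfl)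
  AlgEquiv.restrictNormalHom L₁

theorem restrict_spec {L₁ L₂ : FiniteGaloisIntermediateField K Ω} (h : L₁ ≤ L₂)
    (σ : Gal(L₂/K)) (x : L₁) :
    IntermediateField.inclusion h (restrict h σ x) = σ (IntermediateField.inclusion h x) := by
  let : Algebra L₁ L₂ := (IntermediateField.inclusion h).toRingHom.toAlgebra
  have : IsScalarTower K L₁ L₂ := IsScalarTower.of_algebraMap_eq (fun _ => rfl)
  exact AlgEquiv.restrictNormal_commutes σ L₁ x

theorem restrict_refl (L : FiniteGaloisIntermediateField K Ω) :
    restrict (le_refl L) = MonoidHom.id Gal(L/K) := by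
  ext σ x
  exact congrArg Subtype.val (restrict_spec (le_refl L) σ x)

theorem restrict_comp {L₁ L₂ L₃ : FiniteGaloisIntermediateField K Ω} (h₁ : L₁ ≤ L₂)
    (h₂ : L₂ ≤ L₃) :
    restrict (h₁.trans h₂) = (restrict h₁).comp (restrict h₂) := by
  ext σ x
  have e := congrArg Subtype.val (restrict_spec (h₁.trans h₂) σ x)
  have e₁ := congrArg Subtype.val (restrict_spec h₁ (restrict h₂ σ) x)
  have e₂ := congrArg Subtype.val (restrict_spec h₂ σ (IntermediateField.inclusion h₁ x))
  exact e.trans (e₁.trans e₂).symm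

/-- For finite Galois subextensions `L₁ ⊆ L₂` of `Ω / K`, the inclusion `L₁ˣ → L₂ˣ` as a morphism
of `Gal(L₂/K)`-modules, where `Gal(L₂/K)` acts on `L₁ˣ` through `Gal(L₁/K)`. -/
noncomputable def unitsIncl {L₁ L₂ : FiniteGaloisIntermediateField K Ω} (h : L₁ ≤ L₂) :
    Rep.res (restrict h) (Rep.ofAlgebraAutOnUnits K L₁) ⟶ Rep.ofAlgebraAutOnUnits K L₂ :=
  Rep.ofHom
    ⟨(MonoidHom.toAdditive
        (Units.map (IntermediateField.inclusion h : L₁ →* L₂))).toIntLinearMap, fun σ => by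
      refine LinearMap.ext fun (x : Additive (L₁ : Type)ˣ) => ?_
      exact congrArg Additive.ofMul (Units.ext (restrict_spec h σ (x.toMul : L₁)))⟩

/-- The inflation map `Hⁿ(Gal(L₁/K), L₁ˣ) → Hⁿ(Gal(L₂/K), L₂ˣ)` for finite Galois subextensions
`L₁ ⊆ L₂` of `Ω / K`, induced by restriction of automorphisms and the inclusion of units. -/
noncomputable def inflation {L₁ L₂ : FiniteGaloisIntermediateField K Ω} (h : L₁ ≤ L₂) (n : ℕ) :
    groupCohomology (Rep.ofAlgebraAutOnUnits K L₁) n ⟶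
      groupCohomology (Rep.ofAlgebraAutOnUnits K L₂) n :=
  groupCohomology.map (restrict h) (unitsIncl h) n

variable (K Ω) in
/-- The directed system `L ↦ Hⁿ(Gal(L/K), Lˣ)` over the finite Galois subextensions `L` of `Ω / K`
ordered by inclusion, with the inflation maps as transition maps. -/
noncomputable def cohomologySystem (n : ℕ) : FiniteGaloisIntermediateField K Ω ⥤ ModuleCat ℤ where
  obj L := groupCohomology (Rep.ofAlgebraAutOnUnits K L) n
  map f := inflation (leOfHom f) n
  map_id L := by
    rw [← groupCohomology.map_id]
    exact groupCohomology.map_congr (restrict_refl L) rfl n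
  map_comp f g := by
    rw [inflation, inflation, inflation, ← groupCohomology.map_comp]
    exact groupCohomology.map_congr (restrict_comp (leOfHom f) (leOfHom g)) rfl n

variable (K Ω) in
/-- The Galois cohomology group `Hⁿ(Gal(Ω/K); Ωˣ)` of a Galois extension `Ω / K`: the colimit of
`Hⁿ(Gal(L/K), Lˣ)` over the finite Galois subextensions `L` of `Ω / K`, along inflation maps. -/
noncomputable def H (n : ℕ) : ModuleCat.{0} ℤ :=
  Limits.colimit (cohomologySystem K Ω n)

end GaloisUnits

/-!
The class in question is the fourth cup power of the quadratic character of `K(i) / K`.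

Let `L₀ / K` be finite Galois with `i ∈ L₀`, and let `ε : Gal(L₀/K) → ℤ/2` be the character with
`ε g = 1` exactly when `g i = -i`. Since `±1` is fixed by Galois, the cochain
`(g₁, g₂, g₃, g₄) ↦ (-1) ^ (ε g₁ ε g₂ ε g₃ ε g₄)` is a `4`-cocycle with values in `L₀ˣ`, and its
class is killed by `2` (`groupCohomology.d_quarticCochain`, `GaloisUnits.cocyclesMk_add_self`).

It remains to see that the class does not die in the colimit, i.e. that its inflation to any finite
Galois `L ⊇ L₀` is not a coboundary. As `K` is totally real, complex conjugation (for an embedding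
`L → ℂ`) restricts to an involution `c ∈ Gal(L/K)`
(`GaloisUnits.exists_involution_isConj`). For an involution `c`, the functional
`f ↦ ∑ f(cᵃ, c, cᵇ, c)`, the sum being over `a, b ∈ {0, 1}`, carries coboundaries to norms `y + c y`
(`groupCohomology.sum_involution_d_eq_norm`); it realizes the `2`-periodicity of the cohomology of
`⟨c⟩`. On the cocycle above it takes the value `-1`, since `c i = -i`. But `-1` is not a norm:
`u · c u` is sent to `|u|² ≥ 0` in `ℂ` (`GaloisUnits.d_ne_quarticCochain`).
-/

open CategoryTheory

/-! ### Cochains and cocycles in group cohomology -/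

namespace groupCohomology

universe u

variable {k G : Type u} [CommRing k] [Group G]

/-- For an involution `c`, the functional `f ↦ ∑ f(cᵃ, c, cᵇ, c)` over `a, b ∈ {0, 1}` sends
coboundaries to norms from `⟨c⟩`. It is dual to the comparison map from the periodic resolution of
a group of order two to its bar resolution. -/
theorem sum_involution_d_eq_norm (A : Rep.{u} k G) {c : G} (hc : c * c = 1)
    (h : (Fin 3 → G) → A) :
    ∃ y : A, inhomogeneousCochains.d A 3 h ![1, c, 1, c] +
      inhomogeneousCochains.d A 3 h ![1, c, c, c] +
      inhomogeneousCochains.d A 3 h ![c, c, 1, c] +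
      inhomogeneousCochains.d A 3 h ![c, c, c, c] = y + A.ρ c y := by
  -- Only the terms `g₁ • h(g₂, g₃, g₄)` survive; the others cancel after translating `a` or `b`.
  refine ⟨h ![c, 1, c] + h ![c, c, c], ?_⟩
  have e0 (a b d e : G) : (fun i : Fin 3 => ![a, b, d, e] i.succ) = ![b, d, e] := by
    ext i; fin_cases i <;> rfl
  have e1 (a b d e : G) : Fin.contractNth (0 : Fin 4) (· * ·) ![a, b, d, e] = ![a * b, d, e] := by
    ext i; fin_cases i <;> rfl
  have e2 (a b d e : G) : Fin.contractNth (1 : Fin 4) (· * ·) ![a, b, d, e] = ![a, b * d, e] := by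
    ext i; fin_cases i <;> rfl
  have e3 (a b d e : G) : Fin.contractNth (2 : Fin 4) (· * ·) ![a, b, d, e] = ![a, b, d * e] := by
    ext i; fin_cases i <;> rfl
  have e4 (a b d e : G) : Fin.contractNth (3 : Fin 4) (· * ·) ![a, b, d, e] = ![a, b, d] := by
    ext i; fin_cases i <;> rfl
  simp only [inhomogeneousCochains.d_hom_apply, Fin.sum_univ_four, Nat.reduceAdd, e0, e1, e2, e3,
    e4, hc, one_mul, mul_one, Matrix.cons_val_zero, map_add, map_one, Module.End.one_apply]
  norm_num
  abel

/-- The cochain `(g₁, g₂, g₃, g₄) ↦ a (ε g₁ * ε g₂ * ε g₃ * ε g₄)`: for a character `ε`, the image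
under `a` of the fourth cup power of `ε`, where `ℤ/2` carries the trivial action. -/
def quarticCochain (A : Rep.{u} k G) (ε : G → ZMod 2) (a : ZMod 2 →+ A) : (Fin 4 → G) → A :=
  fun g => a (∏ i, ε (g i))

theorem d_quarticCochain (A : Rep.{u} k G) {ε : G → ZMod 2} (hε : ∀ g h, ε (g * h) = ε g + ε h)
    (a : ZMod 2 →+ A) (ha : ∀ g t, A.ρ g (a t) = a t) :
    inhomogeneousCochains.d A 4 (quarticCochain A ε a) = 0 := by
  funext g
  have e3 : (-1 : k) ^ 3 = -1 := by ring
  have e4 : (-1 : k) ^ 4 = 1 := by ring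
  have e5 : (-1 : k) ^ 5 = -1 := by ring
  simp only [inhomogeneousCochains.d_hom_apply, quarticCochain, ha, Fin.sum_univ_five,
    Fin.prod_univ_four, Fin.contractNth, Nat.reduceAdd]
  simp [hε, e3, e4, e5]
  simp only [← map_add, ← map_neg]
  refine (congrArg a ?_).trans (map_zero a)
  ring

theorem exists_d_eq_of_π_eq_zero {A : Rep.{u} k G} {n : ℕ} {z : cocycles A (n + 1)}
    (hz : π A (n + 1) z = 0) :
    ∃ h, inhomogeneousCochains.d A n h = iCocycles A (n + 1) z := by
  have hex := ShortComplex.exact_of_g_is_cokernel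
    (ShortComplex.mk _ _ ((inhomogeneousCochains A).toCycles_comp_homologyπ n (n + 1)))
    ((inhomogeneousCochains A).homologyIsCokernel n (n + 1) (by simp))
  obtain ⟨h, hh⟩ := (ShortComplex.moduleCat_exact_iff _).1 hex z hz
  refine ⟨h, ?_⟩
  rw [← inhomogeneousCochains.d_def, ← (inhomogeneousCochains A).toCycles_i n (n + 1), ← hh]
  rfl

theorem iCocycles_cocyclesMap {H : Type u} [Group H] {A : Rep.{u} k H} {B : Rep.{u} k G}
    (f : G →* H) (φ : Rep.res f A ⟶ B) (n : ℕ) (z : cocycles A n) (g : Fin n → G) :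
    (iCocycles B n (cocyclesMap f φ n z) : (Fin n → G) → B) g =
      φ.hom ((iCocycles A n z : (Fin n → H) → A) (f ∘ g)) :=
  congrArg (fun F => (F z : (Fin n → G) → B) g)
    (congrArg ModuleCat.Hom.hom (HomologicalComplex.cyclesMap_i (cochainsMap f φ) n))

end groupCohomology

namespace GaloisUnits

variable {K : Type*} {Ω : Type} [Field K] [Field Ω] [Algebra K Ω]

/-! ### Complex conjugation and the quadratic character of `K(i) / K` -/

theorem exists_involution_isConj {L : Type*} [Field L] [Algebra K L] [IsGalois K L]
    [NumberField.IsTotallyReal K] [Algebra ℚ K] [Algebra.IsAlgebraic ℚ K] (φ : L →+* ℂ) :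
    ∃ c : Gal(L/K), c * c = 1 ∧ ∀ x, φ (c x) = starRingEnd ℂ (φ x) := by
  -- `φ` and its conjugate agree on `K`, so they differ by an element of `Gal(L/K)`.
  obtain ⟨σ, hσ⟩ := NumberField.ComplexEmbedding.exists_comp_symm_eq_of_comp_eq (k := K) φ
    (NumberField.ComplexEmbedding.conjugate φ) (by
      have := NumberField.IsTotallyReal.complexEmbedding_isReal (φ.comp (algebraMap K L))
      rw [NumberField.ComplexEmbedding.isReal_iff] at this
      exact this.symm)
  have h (x : L) : φ (σ.symm x) = starRingEnd ℂ (φ x) := RingHom.congr_fun hσ x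
  refine ⟨σ.symm, AlgEquiv.ext fun x => φ.injective ?_, h⟩
  change φ (σ.symm (σ.symm x)) = φ x
  rw [h, h, Complex.conj_conj]

theorem exists_sign_character {L : Type*} [Field L] [Algebra K L] [CharZero L] {i : L}
    (hi : i * i = -1) :
    ∃ ε : Gal(L/K) → ZMod 2, (∀ g h, ε (g * h) = ε g + ε h) ∧ ∀ g, g i = -i → ε g = 1 := by
  have hi0 : i ≠ -i := by
    intro h
    have : i = 0 := by linear_combination h / 2
    simp [this] at hi
  have hor (g : Gal(L/K)) : g i = i ∨ g i = -i := by
    rw [← mul_self_eq_mul_self_iff, ← map_mul, hi, map_neg, map_one]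
  classical
  refine ⟨fun g => if g i = i then 0 else 1, fun g h => ?_, fun g hg => by simp [hg, hi0.symm]⟩
  have h11 : (1 : ZMod 2) + 1 = 0 := by decide
  rcases hor g with hg | hg <;> rcases hor h with hh | hh <;>
    simp [hg, hh, hi0.symm, h11]

/-! ### The sign homomorphism `ℤ/2 → Lˣ` -/

variable (K) in
/-- The homomorphism `t ↦ (-1) ^ t` from `ℤ/2` to `Lˣ`, the latter written additively as the
underlying module of the Galois representation on units. -/
noncomputable def signHom (L : Type*) [Field L] [Algebra K L] :
    ZMod 2 →+ Rep.ofAlgebraAutOnUnits K L :=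
  ZMod.lift 2 ⟨zmultiplesHom (Additive Lˣ) (Additive.ofMul (-1)), by
    change (2 : ℤ) • Additive.ofMul (-1 : Lˣ) = 0
    rw [← ofMul_zpow]
    simp⟩

theorem signHom_one (L : Type*) [Field L] [Algebra K L] :
    signHom K L 1 = Additive.ofMul (-1 : Lˣ) := by
  refine (ZMod.lift_coe 2 (A := Additive Lˣ) _ 1).trans ?_
  simp

theorem ρ_signHom (L : Type*) [Field L] [Algebra K L] (g : Gal(L/K)) (t : ZMod 2) :
    (Rep.ofAlgebraAutOnUnits K L).ρ g (signHom K L t) = signHom K L t := by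
  have h : t = 0 ∨ t = 1 := by revert t; decide
  obtain rfl | rfl := h
  · rw [map_zero, map_zero]
  · rw [signHom_one]
    change Additive.ofMul (g • (-1 : Lˣ)) = _
    congr 1
    ext
    simp

theorem unitsIncl_signHom {L₁ L₂ : FiniteGaloisIntermediateField K Ω} (h : L₁ ≤ L₂) (t : ZMod 2) :
    (unitsIncl h).hom (signHom K L₁ t) = signHom K L₂ t := by
  have ht : t = 0 ∨ t = 1 := by revert t; decide
  obtain rfl | rfl := ht
  · rw [map_zero, map_zero, map_zero]
  · rw [signHom_one, signHom_one]
    refine congrArg Additive.ofMul (Units.ext ?_)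
    exact (map_neg (IntermediateField.inclusion h) 1).trans
      (congrArg Neg.neg (map_one (IntermediateField.inclusion h)))

/-! ### The quartic class -/

theorem exists_injective_of_add_self_eq_zero {M : Type*} [AddCommGroup M] {x : M}
    (hx2 : x + x = 0) (hx0 : x ≠ 0) : ∃ f : ZMod 2 →+ M, Function.Injective f := by
  refine ⟨ZMod.lift 2 ⟨zmultiplesHom M x, ?_⟩, ?_⟩
  · change (2 : ℤ) • x = 0
    rw [two_zsmul, hx2]
  · rw [ZMod.lift_injective]
    intro m hm
    rw [ZMod.intCast_zmod_eq_zero_iff_dvd]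
    rcases Int.even_or_odd' m with ⟨n, rfl | rfl⟩
    · exact dvd_mul_right _ _
    · refine absurd ?_ hx0
      have hm' : (2 * n + 1) • x = 0 := hm
      rwa [add_smul, mul_comm, mul_smul, two_zsmul, hx2, smul_zero, zero_add, one_smul] at hm'

theorem cocyclesMk_add_self {L : Type} [Field L] [Algebra K L] {ε : Gal(L/K) → ZMod 2}
    (hd : inhomogeneousCochains.d (Rep.ofAlgebraAutOnUnits K L) 4
      (groupCohomology.quarticCochain _ ε (signHom K L)) = 0) :
    groupCohomology.cocyclesMk _ hd + groupCohomology.cocyclesMk _ hd = 0 := by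
  refine (ModuleCat.mono_iff_injective
    (groupCohomology.iCocycles (Rep.ofAlgebraAutOnUnits K L) 4)).1 inferInstance ?_
  rw [map_add, groupCohomology.iCocycles_mk, map_zero]
  funext g
  change signHom K L _ + signHom K L _ = 0
  rw [← map_add, CharTwo.add_self_eq_zero, map_zero]

/-- The quartic cocycle is not a coboundary as soon as its character is nontrivial on complex
conjugation: otherwise `-1` would be of the form `u * c u = |u|²`. -/
theorem d_ne_quarticCochain {L : Type} [Field L] [Algebra K L] (φ : L →+* ℂ)
    {c : Gal(L/K)} (hc : c * c = 1) (hφ : ∀ x, φ (c x) = starRingEnd ℂ (φ x))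
    {ε : Gal(L/K) → ZMod 2} (hε1 : ε 1 = 0) (hεc : ε c = 1)
    (h : (Fin 3 → Gal(L/K)) → Rep.ofAlgebraAutOnUnits K L) :
    inhomogeneousCochains.d (Rep.ofAlgebraAutOnUnits K L) 3 h ≠
      groupCohomology.quarticCochain _ ε (signHom K L) := by
  intro hd
  obtain ⟨y, hy⟩ := groupCohomology.sum_involution_d_eq_norm _ hc h
  rw [hd] at hy
  simp only [groupCohomology.quarticCochain, Fin.prod_univ_four, Matrix.cons_val_zero,
    Matrix.cons_val_one, Matrix.cons_val, hε1, hεc, mul_zero, mul_one, map_zero,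
    signHom_one] at hy
  let u : Lˣ := Additive.toMul (α := Lˣ) y
  replace hy : Additive.ofMul (-1 : Lˣ) = y + (Rep.ofAlgebraAutOnUnits K L).ρ c y := by
    rw [← hy]
    abel
  have hu : (-1 : L) = u * c u := congrArg (fun z => ((Additive.toMul (α := Lˣ) z : Lˣ) : L)) hy
  have h1 := congrArg φ hu
  rw [map_mul, hφ, Complex.mul_conj, map_neg, map_one] at h1
  have h2 : (-1 : ℝ) = Complex.normSq (φ u) := by exact_mod_cast h1
  linarith [Complex.normSq_nonneg (φ u)]

end GaloisUnits

theorem mainTheorem11 (K : Type*) [Field K] [Algebra ℚ K] [Algebra.IsAlgebraic ℚ K]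
    [NumberField.IsTotallyReal K]
    (Qbar : Type) [Field Qbar] [Algebra ℚ Qbar] [IsAlgClosure ℚ Qbar]
    [Algebra K Qbar] [IsScalarTower ℚ K Qbar] :
    ∃ f : ZMod 2 →+ GaloisUnits.H K Qbar 4, Function.Injective f := by
  have : IsAlgClosed Qbar := IsAlgClosure.isAlgClosed ℚ
  have : Algebra.IsAlgebraic ℚ Qbar := IsAlgClosure.isAlgebraic
  have : CharZero K := algebraRat.charZero K
  have : CharZero Qbar := algebraRat.charZero Qbar
  have : Algebra.IsAlgebraic K Qbar := Algebra.IsAlgebraic.tower_top (K := ℚ) K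
  have : IsAlgClosure K Qbar := ⟨inferInstance, inferInstance⟩
  have : IsGalois K Qbar := IsAlgClosure.isGalois K Qbar
  let φ : Qbar →ₐ[ℚ] ℂ := IsAlgClosed.lift
  obtain ⟨i, hi⟩ := IsAlgClosed.exists_eq_mul_self (-1 : Qbar)
  let L := FiniteGaloisIntermediateField.adjoin K {i}
  let iL : L := ⟨i, FiniteGaloisIntermediateField.subset_adjoin K {i} rfl⟩
  have hiL : iL * iL = -1 := Subtype.ext hi.symm
  obtain ⟨ε, hε, hε'⟩ := GaloisUnits.exists_sign_character (K := K) hiL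
  have hd := groupCohomology.d_quarticCochain (Rep.ofAlgebraAutOnUnits K L) hε
    (GaloisUnits.signHom K L) (GaloisUnits.ρ_signHom L)
  let z := groupCohomology.cocyclesMk _ hd
  let x : GaloisUnits.H K Qbar 4 := Limits.colimit.ι (GaloisUnits.cohomologySystem K Qbar 4) L
    (groupCohomology.π (Rep.ofAlgebraAutOnUnits K L) 4 z)
  have hx2 : x + x = 0 := by
    let F : groupCohomology.cocycles (Rep.ofAlgebraAutOnUnits K L) 4 →+ GaloisUnits.H K Qbar 4 :=
      (Limits.colimit.ι (GaloisUnits.cohomologySystem K Qbar 4) L).hom.toAddMonoidHom.comp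
        (groupCohomology.π (Rep.ofAlgebraAutOnUnits K L) 4).hom.toAddMonoidHom
    exact (map_add F z z).symm.trans
      ((congrArg F (GaloisUnits.cocyclesMk_add_self hd)).trans (map_zero F))
  have hx0 : x ≠ 0 := by
    intro hx
    -- The inflation of `z` to some finite Galois `M ⊇ L` is a coboundary.
    obtain ⟨M, j, hM⟩ := Limits.Concrete.colimit_rep_eq_zero ℤ
      (GaloisUnits.cohomologySystem K Qbar 4) L _ hx
    have hLM : L ≤ M := leOfHom j
    have hM' : groupCohomology.π (Rep.ofAlgebraAutOnUnits K M) 4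
        (groupCohomology.cocyclesMap (GaloisUnits.restrict hLM) (GaloisUnits.unitsIncl hLM) 4 z)
          = 0 := by
      rw [← groupCohomology.π_map_apply]
      exact hM
    obtain ⟨h, hh⟩ := groupCohomology.exists_d_eq_of_π_eq_zero hM'
    let φM : M →+* ℂ := φ.toRingHom.comp (algebraMap M Qbar)
    obtain ⟨c, hc, hφ⟩ := GaloisUnits.exists_involution_isConj (K := K) φM
    refine GaloisUnits.d_ne_quarticCochain φM hc hφ
      (ε := ε ∘ GaloisUnits.restrict hLM) ?_ ?_ h ?_
    · have := hε 1 1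
      simpa using this
    · -- Conjugation sends `i` to `-i`, since the image of `i` in `ℂ` is `±I`.
      refine hε' _ ((IntermediateField.inclusion hLM).injective (φM.injective ?_))
      change φM (IntermediateField.inclusion hLM _) = φM (IntermediateField.inclusion hLM _)
      rw [GaloisUnits.restrict_spec, hφ, map_neg, map_neg]
      have hsq : φM (IntermediateField.inclusion hLM iL) ^ 2 = -1 := by
        rw [← map_pow, ← map_pow, pow_two, hiL, map_neg, map_neg, map_one, map_one]
      rw [← Complex.I_sq, sq_eq_sq_iff_eq_or_eq_neg] at hsq
      rcases hsq with h | h <;> simp [h]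
    · rw [hh]
      funext g
      rw [groupCohomology.iCocycles_cocyclesMap, groupCohomology.iCocycles_mk]
      exact GaloisUnits.unitsIncl_signHom hLM _
  exact GaloisUnits.exists_injective_of_add_self_eq_zero hx2 hx0
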